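/- For a positive integer $n$ and a real $\theta>0$ let $(\theta)_n=\theta(\theta+1)\cdots(\theta+n-1)$, let $\bar s(n,x)$ be the coefficient of $\theta^x$ in $(\theta)_n$, and let $K=K_{n,\theta}$ be a random variable with $$\mathrm P(K=x)=\frac{\bar s(n,x)\,\theta^x}{(\theta)_n}\qquad(x=1,\dots,n).$$ Let $F_{n,\theta}$ be the distribution function of $(K-\mathrm E[K])/\sqrt{\mathrm{var}(K)}$, let $\Phi$ be the standard normal distribution function, and put $\|F_{n,\theta}-\Phi\|_\infty=\sup_{x\in\mathbb R}|F_{n,\theta}(x)-\Phi(x)|$. Let $\theta=\theta_n>0$ be nondecreasing in $n$. Suppose that, as $n\to\infty$, one of the following holds: - Case A: $n/\theta\to\infty$; - Case B: $n/\theta\to c$ for some $0<c<\infty$; - Case C1: $n/\theta\to0$ and $n^2/\theta\to\infty$. Then, as $n\to\infty$, $$\|F_{n,\theta}-\Phi\|_\infty=O\!\left(\frac1{\sqrt{\theta\{\log(1+n/\theta)-1+\theta/(n+\theta)\}}}\right).$$ Moreover, the quantity inside this $O(\cdot)$, and hence also $\|F_{n,\theta}-\Phi\|_\infty$, is $O\bigl(1/\sqrt{\theta\log(n/\theta)}\bigr)$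 in Case A, $O\bigl(1/\sqrt{\theta}\bigr)$ in Case B, and $O\bigl(1/\sqrt{n^2/\theta}\bigr)$ in Case C1. -/

import Mathlib

open Filter Asymptotics MeasureTheory ProbabilityTheory

noncomputable section

/-- The probability weight `s̄(n, x) θ ^ x / (θ)_n`, where `(θ)_n = θ (θ + 1) ⋯ (θ + n - 1)` is the
rising factorial and `s̄(n, x)` is the coefficient of `θ ^ x` in `(θ)_n`. -/
def ewensLengthWeight (n : ℕ) (θ : ℝ) (x : ℕ) : ℝ :=
  ((ascPochhammer ℕ n).coeff x : ℝ) * θ ^ x / (ascPochhammer ℝ n).eval θ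

/-- The law on `ℕ` of the length `K` of a Ewens partition:
`P(K = x) = s̄(n, x) θ ^ x / (θ)_n` for `x = 1, …, n`. -/
def ewensLengthLaw (n : ℕ) (θ : ℝ) : Measure ℕ :=
  ∑ x ∈ Finset.Icc 1 n, ENNReal.ofReal (ewensLengthWeight n θ x) • Measure.dirac x

/-- For `n ≥ 1` and `θ > 0` the weights are those of a probability measure. -/
theorem isProbabilityMeasure_ewensLengthLaw {n : ℕ} (hn : 1 ≤ n) {θ : ℝ} (hθ : 0 < θ) :
    IsProbabilityMeasure (ewensLengthLaw n θ) := by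
  have hpos : 0 < (ascPochhammer ℝ n).eval θ := ascPochhammer_pos n θ hθ
  have hw : ∀ x ∈ Finset.Icc 1 n, 0 ≤ ewensLengthWeight n θ x := by
    intro x _
    unfold ewensLengthWeight
    positivity
  have hsum : ∑ x ∈ Finset.Icc 1 n, ewensLengthWeight n θ x = 1 := by
    unfold ewensLengthWeight
    rw [← Finset.sum_div, div_eq_one_iff_eq hpos.ne']
    have hdeg : (ascPochhammer ℝ n).natDegree = n := ascPochhammer_natDegree ℝ n
    have h0 : (ascPochhammer ℕ n).coeff 0 = 0 := by
      rw [Polynomial.coeff_zero_eq_eval_zero, ascPochhammer_eval_zero, if_neg (by omega)]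
    rw [Polynomial.eval_eq_sum_range, hdeg, Finset.range_eq_Ico, Finset.sum_eq_sum_Ico_succ_bot
      (by omega)]
    have hc : ∀ x, (ascPochhammer ℝ n).coeff x = ((ascPochhammer ℕ n).coeff x : ℝ) := by
      intro x
      rw [← ascPochhammer_map (Nat.castRingHom ℝ) n, Polynomial.coeff_map]
      simp
    simp only [hc, h0]
    simp only [Nat.cast_zero, zero_mul, zero_add]
    rfl
  constructor
  simp only [ewensLengthLaw, Measure.finsetSum_apply, Measure.smul_apply, measure_univ,
    smul_eq_mul, mul_one]
  rw [← ENNReal.ofReal_sum_of_nonneg hw, hsum, ENNReal.ofReal_one]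

/-- The random variable `K` standardized by its exact mean and standard deviation,
`X = (K - E[K]) / √(var K)`. -/
def standardized {Ω : Type*} [MeasurableSpace Ω] (P : Measure Ω) (K : Ω → ℕ) (ω : Ω) : ℝ :=
  ((K ω : ℝ) - ∫ ω', (K ω' : ℝ) ∂P) / √(variance (fun ω' => (K ω' : ℝ)) P)

/-- The distribution function `F(x) = P(X ≤ x)` of the standardized variable `X`. -/
def standardizedCDF {Ω : Type*} [MeasurableSpace Ω] (P : Measure Ω) (K : Ω → ℕ) (x : ℝ) : ℝ :=
  P.real {ω | standardized P K ω ≤ x}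

/-- The distribution function `Φ` of the standard normal distribution. -/
def stdNormalCDF (x : ℝ) : ℝ :=
  (gaussianReal 0 1).real (Set.Iic x)

/-- The error `‖F - Φ‖_∞ = sup_x |F(x) - Φ(x)|` of the normal approximation to `X`. -/
def normalApproxError {Ω : Type*} [MeasurableSpace Ω] (P : Measure Ω) (K : Ω → ℕ) : ℝ :=
  ⨆ x : ℝ, |standardizedCDF P K x - stdNormalCDF x|

/-- The rate `1 / √(θ {log (1 + n / θ) - 1 + θ / (n + θ)})`. -/
def generalRate (n : ℕ) (θ : ℝ) : ℝ :=
  1 / √(θ * (Real.log (1 + n / θ) - 1 + θ / (n + θ)))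

end

/-!
The generating function `(θ x)(θ x + 1) ⋯ (θ x + n - 1) / (θ)_n` of `K` factors linearly, so `K` is
distributed as a sum of independent Bernoulli variables with success probabilities
`p i = θ / (θ + i)`, `i < n` (`sum_ewensLengthWeight_mul`). The theorem therefore reduces to a
Berry–Esseen bound `‖F - Φ‖_∞ ≤ 9 / σ` for Bernoulli sums of variance `σ ^ 2`
(`abs_bernoulliSumExp_indicator_sub_le`) and a lower bound for `σ ^ 2`.

The Berry–Esseen bound comes from Stein's method. Write `W = (S - E[S]) / σ`, and let `f` be the
bounded solution of `f'(w) = w f(w) + 1(w ≤ z) - Φ(z)`. Since a Bernoulli variable `X` satisfies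
`E[(X - p) h(X)] = p (1 - p) (h 1 - h 0)`, one has the exact identity
`E[W f(W)] = ∑ i, p i (1 - p i) / σ * E[f(W i + 1 / σ) - f(W i)]`, where `W i` omits the `i`-th
summand and so is `W` or `W - 1 / σ` (`bernoulliSumExp_stein`). The increments of `f` are averages
of `w f(w) + 1(w ≤ z) - Φ(z)` over points within `1 / σ` of `W`, and `w f(w)` varies by at most
`(2 |W| + 6) / σ` there. Thus the terms `E[W f(W)]` cancel up to `8 / σ`, and what is left is
`P(W + 1 / σ ≤ z) - Φ(z) ≤ 8 / σ` and the analogous lower bound; shifting `z` by `1 / σ` costs one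
more `1 / σ` because `Φ` is `1`-Lipschitz.

The variance is `σ ^ 2 = ∑ i, p i - ∑ i, (p i) ^ 2`. Comparing the first sum with a logarithm and
the second with a telescoping sum gives `σ ^ 2 ≥ L - 1`, where
`L = θ (log (1 + n / θ) - 1 + θ / (n + θ))` is the quantity in the general rate
(`le_sum_fellerProb_variance`). Together with the trivial bound `‖F - Φ‖_∞ ≤ 1` for `L ≤ 2`, this
yields `‖F - Φ‖_∞ ≤ 18 / √L` for every `n ≥ 1` and `θ > 0`. The rates in the three cases follow from
elementary lower bounds for `log (1 + t) - 1 + 1 / (1 + t)` at `t = n / θ`.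
-/

/-! ### The standard normal distribution -/

theorem stdNormalCDF_eq_integral (x : ℝ) :
    stdNormalCDF x = ∫ t in Set.Iic x, gaussianPDFReal 0 1 t := by
  rw [stdNormalCDF, Measure.real, gaussianReal_apply_eq_integral 0 one_ne_zero,
    ENNReal.toReal_ofReal (integral_nonneg fun t => gaussianPDFReal_nonneg 0 1 t)]

theorem stdNormalCDF_nonneg (x : ℝ) : 0 ≤ stdNormalCDF x := measureReal_nonneg

theorem stdNormalCDF_le_one (x : ℝ) : stdNormalCDF x ≤ 1 := measureReal_le_one

theorem stdNormalCDF_mono : Monotone stdNormalCDF := fun _ _ h =>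
  measureReal_mono (Set.Iic_subset_Iic.2 h)

theorem stdNormalCDF_neg (x : ℝ) : stdNormalCDF (-x) = 1 - stdNormalCDF x := by
  have : NullSingletonClass (gaussianReal 0 1) := nullSingletonClass_gaussianReal one_ne_zero
  have h1 : (gaussianReal 0 1).real (Set.Iic (-x)) = (gaussianReal 0 1).real (Set.Ici x) := by
    conv_lhs => rw [← neg_zero, ← gaussianReal_map_neg]
    rw [map_measureReal_apply measurable_neg measurableSet_Iic]
    congr 1
    ext t
    simp
  have h2 : (gaussianReal 0 1).real (Set.Ici x) = (gaussianReal 0 1).real (Set.Ioi x) :=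
    measureReal_congr Ioi_ae_eq_Ici.symm
  rw [stdNormalCDF, stdNormalCDF, h1, h2, ← Set.compl_Iic,
    probReal_compl_eq_one_sub measurableSet_Iic]

theorem stdGaussianPDF_eq (x : ℝ) :
    gaussianPDFReal 0 1 x = (√(2 * Real.pi))⁻¹ * Real.exp (-(1 / 2) * x ^ 2) := by
  simp only [gaussianPDFReal_def, NNReal.coe_one, mul_one, sub_zero]
  congr 2
  ring

theorem stdGaussianPDF_pos (x : ℝ) : 0 < gaussianPDFReal 0 1 x :=
  gaussianPDFReal_pos 0 1 x one_ne_zero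

theorem hasDerivAt_stdGaussianPDF (x : ℝ) :
    HasDerivAt (gaussianPDFReal 0 1) (-(x * gaussianPDFReal 0 1 x)) x := by
  rw [funext stdGaussianPDF_eq]
  have h := ((((hasDerivAt_id x).pow 2).const_mul (-(1 / 2 : ℝ))).exp).const_mul
    (√(2 * Real.pi))⁻¹
  refine h.congr_deriv ?_
  simp
  ring

theorem continuous_stdGaussianPDF : Continuous (gaussianPDFReal 0 1) :=
  continuous_iff_continuousAt.2 fun x => (hasDerivAt_stdGaussianPDF x).continuousAt

theorem hasDerivAt_stdNormalCDF (x : ℝ) :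
    HasDerivAt stdNormalCDF (gaussianPDFReal 0 1 x) x := by
  have hint := integrable_gaussianPDFReal 0 1
  have h : stdNormalCDF =
      fun y => stdNormalCDF 0 + ∫ t in (0 : ℝ)..y, gaussianPDFReal 0 1 t := by
    funext y
    rw [← intervalIntegral.integral_Iic_sub_Iic hint.integrableOn hint.integrableOn,
      stdNormalCDF_eq_integral, stdNormalCDF_eq_integral]
    ring
  rw [h]
  exact (intervalIntegral.integral_hasDerivAt_right hint.intervalIntegrable
    (continuous_stdGaussianPDF.stronglyMeasurableAtFilter _ _)
    continuous_stdGaussianPDF.continuousAt).const_add _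

theorem continuous_stdNormalCDF : Continuous stdNormalCDF :=
  continuous_iff_continuousAt.2 fun x => (hasDerivAt_stdNormalCDF x).continuousAt

theorem stdGaussianPDF_le_one (x : ℝ) : gaussianPDFReal 0 1 x ≤ 1 := by
  rw [stdGaussianPDF_eq]
  have h1 : (√(2 * Real.pi))⁻¹ ≤ 1 := by
    apply inv_le_one_of_one_le₀
    rw [Real.one_le_sqrt]
    linarith [Real.pi_gt_three]
  have h2 : Real.exp (-(1 / 2) * x ^ 2) ≤ 1 := by
    rw [Real.exp_le_one_iff]
    nlinarith [sq_nonneg x]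
  exact mul_le_one₀ h1 (Real.exp_nonneg _) h2

theorem stdNormalCDF_add_le (x : ℝ) {d : ℝ} (hd : 0 ≤ d) :
    stdNormalCDF (x + d) ≤ stdNormalCDF x + d := by
  have h := image_sub_le_mul_sub_of_deriv_le (C := 1)
    (fun x => (hasDerivAt_stdNormalCDF x).differentiableAt)
    (fun x => by rw [(hasDerivAt_stdNormalCDF x).deriv]; exact stdGaussianPDF_le_one x)
    (show x ≤ x + d by linarith)
  linarith

/-- Mills' inequality for the lower tail. It holds because
`∫ t in Iic w, -t φ(t) = φ(w)` for the normal density `φ`. -/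
theorem neg_mul_stdNormalCDF_le (w : ℝ) :
    -w * stdNormalCDF w ≤ gaussianPDFReal 0 1 w := by
  have hint : Integrable (fun t => -(t * gaussianPDFReal 0 1 t)) := by
    have h := (integrable_mul_exp_neg_mul_sq (b := 1 / 2) (by norm_num)).const_mul
      (-(√(2 * Real.pi))⁻¹)
    refine h.congr (ae_of_all _ fun t => ?_)
    simp only [stdGaussianPDF_eq]
    ring
  have hlim : Tendsto (gaussianPDFReal 0 1) atBot (nhds 0) := by
    rw [funext stdGaussianPDF_eq]
    have h1 : Tendsto (fun t : ℝ => -(1 / 2) * t ^ 2) atBot atBot := by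
      refine Tendsto.const_mul_atTop_of_neg (by norm_num) ?_
      exact (tendsto_pow_atTop two_ne_zero).comp tendsto_abs_atBot_atTop |>.congr
        fun t => by simp
    simpa using (Real.tendsto_exp_atBot.comp h1).const_mul (√(2 * Real.pi))⁻¹
  have h := integral_Iic_of_hasDerivAt_of_tendsto (a := w)
    (hasDerivAt_stdGaussianPDF w).continuousAt.continuousWithinAt
    (fun t _ => hasDerivAt_stdGaussianPDF t) hint.integrableOn hlim
  rw [sub_zero] at h
  rw [stdNormalCDF_eq_integral, ← h, ← integral_const_mul]
  refine setIntegral_mono_on ((integrable_gaussianPDFReal 0 1).const_mul _).integrableOn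
    hint.integrableOn measurableSet_Iic fun t ht => ?_
  have ht : t ≤ w := ht
  nlinarith [stdGaussianPDF_pos t]

theorem mul_one_sub_stdNormalCDF_le (w : ℝ) :
    w * (1 - stdNormalCDF w) ≤ gaussianPDFReal 0 1 w := by
  have h := neg_mul_stdNormalCDF_le (-w)
  rw [stdNormalCDF_neg] at h
  have h2 : gaussianPDFReal 0 1 (-w) = gaussianPDFReal 0 1 w := by
    simp [stdGaussianPDF_eq]
  rw [h2] at h
  linarith

/-! ### The solution of Stein's equation for a half-line -/

/-- The bounded solution `f` of Stein's equation `f'(w) = w f(w) + 1(w ≤ z) - Φ(z)`, written as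
`f(w) = Φ(w ∧ z) (1 - Φ(w ∨ z)) / φ(w)`. -/
noncomputable def steinSolution (z w : ℝ) : ℝ :=
  stdNormalCDF (min w z) * (1 - stdNormalCDF (max w z)) / gaussianPDFReal 0 1 w

theorem continuous_steinSolution (z : ℝ) : Continuous (steinSolution z) := by
  unfold steinSolution
  refine Continuous.div ?_ continuous_stdGaussianPDF fun w => (stdGaussianPDF_pos w).ne'
  exact (continuous_stdNormalCDF.comp (continuous_id.min continuous_const)).mul
    (continuous_const.sub (continuous_stdNormalCDF.comp (continuous_id.max continuous_const)))

theorem steinSolution_nonneg (z w : ℝ) : 0 ≤ steinSolution z w :=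
  div_nonneg (mul_nonneg (stdNormalCDF_nonneg _) (sub_nonneg.2 (stdNormalCDF_le_one _)))
    (stdGaussianPDF_pos w).le

theorem steinSolution_le_left (z w : ℝ) :
    steinSolution z w ≤ stdNormalCDF w / gaussianPDFReal 0 1 w := by
  refine div_le_div_of_nonneg_right ?_ (stdGaussianPDF_pos w).le
  have h1 := stdNormalCDF_mono (min_le_left w z)
  have h2 := stdNormalCDF_nonneg (min w z)
  have h3 := stdNormalCDF_nonneg (max w z)
  nlinarith

theorem steinSolution_le_right (z w : ℝ) :
    steinSolution z w ≤ (1 - stdNormalCDF w) / gaussianPDFReal 0 1 w := by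
  refine div_le_div_of_nonneg_right ?_ (stdGaussianPDF_pos w).le
  have h1 := stdNormalCDF_mono (le_max_left w z)
  have h2 := stdNormalCDF_le_one (min w z)
  have h3 := stdNormalCDF_le_one (max w z)
  nlinarith

theorem abs_mul_steinSolution_le_one (z w : ℝ) : |w * steinSolution z w| ≤ 1 := by
  have hφ := stdGaussianPDF_pos w
  rw [abs_mul, abs_of_nonneg (steinSolution_nonneg z w)]
  rcases le_total 0 w with hw | hw
  · rw [abs_of_nonneg hw]
    refine (mul_le_mul_of_nonneg_left (steinSolution_le_right z w) hw).trans ?_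
    rw [← mul_div_assoc, div_le_one hφ]
    exact mul_one_sub_stdNormalCDF_le w
  · rw [abs_of_nonpos hw]
    refine (mul_le_mul_of_nonneg_left (steinSolution_le_left z w) (neg_nonneg.2 hw)).trans ?_
    rw [← mul_div_assoc, div_le_one hφ]
    exact neg_mul_stdNormalCDF_le w

theorem steinSolution_le_six (z w : ℝ) : steinSolution z w ≤ 6 := by
  have h0 := steinSolution_nonneg z w
  rcases le_total 1 |w| with hw | hw
  · have h := abs_mul_steinSolution_le_one z w
    rw [abs_mul, abs_of_nonneg h0] at h
    nlinarith
  · -- On `[-1, 1]` the density is at least `e^{-1/2} / √(2π) ≥ 1 / 6`.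
    refine (steinSolution_le_left z w).trans ?_
    rw [div_le_iff₀ (stdGaussianPDF_pos w)]
    refine (stdNormalCDF_le_one w).trans ?_
    rw [stdGaussianPDF_eq]
    have h1 : (13 / 5 : ℝ)⁻¹ * (1 / 2) ≤ (√(2 * Real.pi))⁻¹ * Real.exp (-(1 / 2) * w ^ 2) := by
      refine mul_le_mul (inv_anti₀ (by positivity) ?_) ?_ (by norm_num) (by positivity)
      · rw [Real.sqrt_le_left (by norm_num)]
        nlinarith [Real.pi_lt_d2, hw]
      · have := Real.add_one_le_exp (-(1 / 2) * w ^ 2)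
        have h2 : w ^ 2 ≤ 1 := (sq_le_one_iff_abs_le_one w).2 hw
        linarith
    linarith

theorem hasDerivWithinAt_steinSolution (z w : ℝ) :
    HasDerivWithinAt (steinSolution z)
      (w * steinSolution z w + (if w < z then 1 else 0) - stdNormalCDF z) (Set.Ici w) w := by
  have hφ := (stdGaussianPDF_pos w).ne'
  have hN := hasDerivAt_stdNormalCDF w
  split_ifs with h
  · have hd := (hN.mul_const (1 - stdNormalCDF z)).div (hasDerivAt_stdGaussianPDF w) hφ
    have heq : steinSolution z =ᶠ[nhds w]
        (fun y => stdNormalCDF y * (1 - stdNormalCDF z)) / gaussianPDFReal 0 1 := by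
      filter_upwards [eventually_lt_nhds h] with y hy
      simp [steinSolution, hy.le]
    refine ((hd.congr_of_eventuallyEq heq).congr_deriv ?_).hasDerivWithinAt
    rw [heq.eq_of_nhds]
    simp only [Pi.div_apply]
    field_simp
    ring
  · push Not at h
    have hd := ((hN.const_sub 1).const_mul (stdNormalCDF z)).div (hasDerivAt_stdGaussianPDF w) hφ
    have heq : ∀ y ∈ Set.Ici w, steinSolution z y =
        ((fun y => stdNormalCDF z * (1 - stdNormalCDF y)) / gaussianPDFReal 0 1) y := by
      intro y hy
      have hy : z ≤ y := h.trans hy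
      simp [steinSolution, hy]
    refine (hd.hasDerivWithinAt.congr heq (heq w Set.self_mem_Ici)).congr_deriv ?_
    rw [heq w Set.self_mem_Ici]
    simp only [Pi.div_apply]
    field_simp
    ring

theorem abs_steinSolution_sub_le (z : ℝ) {a b : ℝ} (hab : a ≤ b) :
    |steinSolution z b - steinSolution z a| ≤ 2 * (b - a) := by
  refine norm_image_sub_le_of_norm_deriv_right_le_segment
    (continuous_steinSolution z).continuousOn
    (fun x _ => hasDerivWithinAt_steinSolution z x) (fun x _ => ?_) b ⟨hab, le_rfl⟩
  have h1 := abs_le.1 (abs_mul_steinSolution_le_one z x)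
  have h2 := stdNormalCDF_nonneg z
  have h3 := stdNormalCDF_le_one z
  rw [Real.norm_eq_abs, abs_le]
  split_ifs <;> constructor <;> linarith

/-- The map `w ↦ w f(w)` has modulus of continuity growing linearly in `|w|`. -/
theorem abs_mul_steinSolution_sub_le (z w x : ℝ) :
    |x * steinSolution z x - w * steinSolution z w| ≤ (2 * |w| + 6) * |x - w| := by
  have h1 : |steinSolution z x - steinSolution z w| ≤ 2 * |x - w| := by
    rcases le_total w x with h | h
    · rw [abs_of_nonneg (sub_nonneg.2 h)]
      exact abs_steinSolution_sub_le z h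
    · rw [abs_sub_comm, abs_sub_comm x, abs_of_nonneg (sub_nonneg.2 h)]
      exact abs_steinSolution_sub_le z h
  have h2 : x * steinSolution z x - w * steinSolution z w =
      w * (steinSolution z x - steinSolution z w) + steinSolution z x * (x - w) := by ring
  rw [h2]
  refine (abs_add_le _ _).trans ?_
  rw [abs_mul, abs_mul, abs_of_nonneg (steinSolution_nonneg z x)]
  have h3 := steinSolution_le_six z x
  nlinarith [abs_nonneg w, abs_nonneg (x - w)]

/-- Lower bound for the increment of `f` over `[a, b]`, from Stein's equation. -/
theorem le_steinSolution_sub {z a b c : ℝ} (hab : a ≤ b)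
    (hc : ∀ x ∈ Set.Icc a b, c ≤ x * steinSolution z x) :
    (c + (if b ≤ z then 1 else 0) - stdNormalCDF z) * (b - a) ≤
      steinSolution z b - steinSolution z a := by
  set C := c + (if b ≤ z then 1 else 0) - stdNormalCDF z with hC
  have h := image_le_of_deriv_right_le_deriv_boundary
    (f := fun x => steinSolution z a + C * (x - a)) (f' := fun _ => C) (a := a) (b := b)
    (by fun_prop)
    (fun x _ => by
      simpa using ((((hasDerivAt_id x).sub_const a).const_mul C).const_add
        (steinSolution z a)).hasDerivWithinAt)
    (B := steinSolution z) (by simp) (continuous_steinSolution z).continuousOn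
    (fun x _ => hasDerivWithinAt_steinSolution z x)
    (fun x hx => by
      have h1 := hc x ⟨hx.1, hx.2.le⟩
      have h2 : (if b ≤ z then (1 : ℝ) else 0) ≤ if x < z then 1 else 0 := by
        split_ifs with h3 h4
        · exact le_rfl
        · exact absurd (hx.2.trans_le h3) h4
        · exact zero_le_one
        · exact le_rfl
      rw [hC]
      linarith) (Set.right_mem_Icc.2 hab)
  linarith

/-- Upper bound for the increment of `f` over `[a, b]`, from Stein's equation. -/
theorem steinSolution_sub_le {z a b c : ℝ} (hab : a ≤ b)
    (hc : ∀ x ∈ Set.Icc a b, x * steinSolution z x ≤ c) :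
    steinSolution z b - steinSolution z a ≤
      (c + (if a ≤ z then 1 else 0) - stdNormalCDF z) * (b - a) := by
  set C := c + (if a ≤ z then 1 else 0) - stdNormalCDF z with hC
  have h := image_le_of_deriv_right_le_deriv_boundary
    (B := fun x => steinSolution z a + C * (x - a)) (B' := fun _ => C) (a := a) (b := b)
    (f := steinSolution z) (continuous_steinSolution z).continuousOn
    (fun x _ => hasDerivWithinAt_steinSolution z x) (by simp) (by fun_prop)
    (fun x _ => by
      simpa using ((((hasDerivAt_id x).sub_const a).const_mul C).const_add
        (steinSolution z a)).hasDerivWithinAt)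
    (fun x hx => by
      have h1 := hc x ⟨hx.1, hx.2.le⟩
      have h2 : (if x < z then (1 : ℝ) else 0) ≤ if a ≤ z then 1 else 0 := by
        split_ifs with h3 h4
        · exact le_rfl
        · exact absurd (hx.1.trans h3.le) h4
        · exact zero_le_one
        · exact le_rfl
      rw [hC]
      linarith) (Set.right_mem_Icc.2 hab)
  linarith

/-! ### Sums of independent Bernoulli variables -/

/-- The expectation `E[g(S)]` for a sum `S` of `n` independent Bernoulli variables with success
probabilities `p 0, …, p (n - 1)`, by conditioning on the last summand. -/
noncomputable def bernoulliSumExp (p : ℕ → ℝ) : ℕ → (ℕ → ℝ) → ℝ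
  | 0, g => g 0
  | n + 1, g => (1 - p n) * bernoulliSumExp p n g + p n * bernoulliSumExp p n fun s => g (s + 1)

/-- The sum `∑ i < n, p i (1 - p i) E[G(S - X i)]` over the summands `X i` of `S`, by splitting off
the last index and conditioning on the last summand in the other terms. -/
noncomputable def bernoulliLeaveOneOut (p : ℕ → ℝ) : ℕ → (ℕ → ℝ) → ℝ
  | 0, _ => 0
  | n + 1, G => (1 - p n) * bernoulliLeaveOneOut p n G +
      p n * bernoulliLeaveOneOut p n (fun s => G (s + 1)) +
      p n * (1 - p n) * bernoulliSumExp p n G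

section BernoulliSum

variable {p : ℕ → ℝ}

theorem bernoulliSumExp_add (n : ℕ) (g h : ℕ → ℝ) :
    bernoulliSumExp p n (fun s => g s + h s) = bernoulliSumExp p n g + bernoulliSumExp p n h := by
  induction n generalizing g h with
  | zero => rfl
  | succ n ih => simp only [bernoulliSumExp, ih]; ring

theorem bernoulliSumExp_const_mul (n : ℕ) (c : ℝ) (g : ℕ → ℝ) :
    bernoulliSumExp p n (fun s => c * g s) = c * bernoulliSumExp p n g := by
  induction n generalizing g with
  | zero => rfl
  | succ n ih => simp only [bernoulliSumExp, ih]; ring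

theorem bernoulliSumExp_const (n : ℕ) (c : ℝ) : bernoulliSumExp p n (fun _ => c) = c := by
  induction n with
  | zero => rfl
  | succ n ih => simp only [bernoulliSumExp, ih]; ring

theorem bernoulliSumExp_mono (h0 : ∀ i, 0 ≤ p i) (h1 : ∀ i, p i ≤ 1) (n : ℕ) {g h : ℕ → ℝ}
    (hgh : ∀ s, g s ≤ h s) : bernoulliSumExp p n g ≤ bernoulliSumExp p n h := by
  induction n generalizing g h with
  | zero => exact hgh 0
  | succ n ih =>
    exact add_le_add (mul_le_mul_of_nonneg_left (ih hgh) (sub_nonneg.2 (h1 n)))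
      (mul_le_mul_of_nonneg_left (ih fun s => hgh (s + 1)) (h0 n))

/-- Each `X i` satisfies `E[(X i - p i) h(X i)] = p i (1 - p i) (h 1 - h 0)`; summing over `i`
gives this exact form of Stein's identity. -/
theorem bernoulliSumExp_stein (n : ℕ) (g : ℕ → ℝ) :
    bernoulliSumExp p n (fun s => ((s : ℝ) - ∑ i ∈ Finset.range n, p i) * g s) =
      bernoulliLeaveOneOut p n fun s => g (s + 1) - g s := by
  induction n generalizing g with
  | zero => simp [bernoulliSumExp, bernoulliLeaveOneOut]
  | succ n ih =>
    simp only [bernoulliSumExp, bernoulliLeaveOneOut, Finset.sum_range_succ]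
    have i1 := ih g
    have i2 := ih fun s => g (s + 1)
    set m := ∑ i ∈ Finset.range n, p i
    have e1 : (fun s : ℕ => ((s : ℝ) - (m + p n)) * g s) =
        fun s : ℕ => ((s : ℝ) - m) * g s + (-p n) * g s := by funext s; ring
    have e2 : (fun s : ℕ => (((s + 1 : ℕ) : ℝ) - (m + p n)) * g (s + 1)) =
        fun s : ℕ => ((s : ℝ) - m) * g (s + 1) + (1 - p n) * g (s + 1) := by
      funext s; push_cast; ring
    have e3 : bernoulliSumExp p n (fun s => g (s + 1) - g s) =
        bernoulliSumExp p n (fun s => g (s + 1)) - bernoulliSumExp p n g := by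
      have e : (fun s : ℕ => g (s + 1) - g s) = fun s : ℕ => g (s + 1) + (-1) * g s := by
        funext s; ring
      rw [e, bernoulliSumExp_add, bernoulliSumExp_const_mul]
      ring
    rw [e1, e2, e3, bernoulliSumExp_add, bernoulliSumExp_add, bernoulliSumExp_const_mul,
      bernoulliSumExp_const_mul, i1, i2]
    ring

/-- Since `S - X i` is `S` or `S - 1`, a pointwise bound valid at both positions passes to the
leave-one-out sum. -/
theorem bernoulliLeaveOneOut_le (h0 : ∀ i, 0 ≤ p i) (h1 : ∀ i, p i ≤ 1) (n : ℕ) {G H : ℕ → ℝ}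
    (hs : ∀ s, G s ≤ H s) (hs' : ∀ s, G s ≤ H (s + 1)) :
    bernoulliLeaveOneOut p n G ≤
      (∑ i ∈ Finset.range n, p i * (1 - p i)) * bernoulliSumExp p n H := by
  induction n generalizing G H with
  | zero => simp [bernoulliLeaveOneOut]
  | succ n ih =>
    have hp := h0 n
    have hq : 0 ≤ 1 - p n := sub_nonneg.2 (h1 n)
    have a1 := mul_le_mul_of_nonneg_left (ih hs hs') hq
    have a2 := mul_le_mul_of_nonneg_left
      (ih (fun s => hs (s + 1)) (fun s => hs' (s + 1))) hp
    have a3 := mul_le_mul_of_nonneg_left (bernoulliSumExp_mono h0 h1 n hs) hq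
    have a4 := mul_le_mul_of_nonneg_left (bernoulliSumExp_mono h0 h1 n hs') hp
    have a5 := mul_le_mul_of_nonneg_left (add_le_add a3 a4) (mul_nonneg hp hq)
    simp only [bernoulliSumExp, bernoulliLeaveOneOut, Finset.sum_range_succ]
    linarith

theorem bernoulliLeaveOneOut_const_mul (n : ℕ) (c : ℝ) (G : ℕ → ℝ) :
    bernoulliLeaveOneOut p n (fun s => c * G s) = c * bernoulliLeaveOneOut p n G := by
  induction n generalizing G with
  | zero => simp [bernoulliLeaveOneOut]
  | succ n ih => simp only [bernoulliLeaveOneOut, bernoulliSumExp_const_mul, ih]; ring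

theorem le_bernoulliLeaveOneOut (h0 : ∀ i, 0 ≤ p i) (h1 : ∀ i, p i ≤ 1) (n : ℕ) {G H : ℕ → ℝ}
    (hs : ∀ s, H s ≤ G s) (hs' : ∀ s, H (s + 1) ≤ G s) :
    (∑ i ∈ Finset.range n, p i * (1 - p i)) * bernoulliSumExp p n H ≤
      bernoulliLeaveOneOut p n G := by
  have h := bernoulliLeaveOneOut_le h0 h1 n (G := fun s => -1 * G s) (H := fun s => -1 * H s)
    (fun s => by linarith [hs s]) (fun s => by linarith [hs' s])
  rw [bernoulliLeaveOneOut_const_mul, bernoulliSumExp_const_mul] at h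
  linarith

theorem bernoulliLeaveOneOut_one (n : ℕ) :
    bernoulliLeaveOneOut p n (fun _ => 1) = ∑ i ∈ Finset.range n, p i * (1 - p i) := by
  induction n with
  | zero => rfl
  | succ n ih =>
    simp only [bernoulliLeaveOneOut, bernoulliSumExp_const, ih, Finset.sum_range_succ]; ring

theorem bernoulliSumExp_id (n : ℕ) :
    bernoulliSumExp p n (fun s => (s : ℝ)) = ∑ i ∈ Finset.range n, p i := by
  have h := bernoulliSumExp_stein (p := p) n fun _ => 1
  have hD : bernoulliLeaveOneOut p n (fun _ => 0) = 0 := by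
    simpa using bernoulliLeaveOneOut_const_mul (p := p) n 0 fun _ => 1
  simp only [mul_one, sub_self, hD, sub_eq_add_neg, bernoulliSumExp_add,
    bernoulliSumExp_const] at h
  linarith

theorem bernoulliSumExp_sq (n : ℕ) :
    bernoulliSumExp p n (fun s => ((s : ℝ) - ∑ i ∈ Finset.range n, p i) ^ 2) =
      ∑ i ∈ Finset.range n, p i * (1 - p i) := by
  have h := bernoulliSumExp_stein (p := p) n fun s => (s : ℝ) - ∑ i ∈ Finset.range n, p i
  rw [← bernoulliLeaveOneOut_one]
  convert h using 2
  · funext s; ring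
  · funext s; push_cast; ring

/-- The distribution function of the standardized sum is compared with `Φ` at points one lattice
step apart: this is Stein's identity applied to the solution of Stein's equation. -/
theorem bernoulliSumExp_indicator_bounds (h0 : ∀ i, 0 ≤ p i) (h1 : ∀ i, p i ≤ 1) (n : ℕ) {σ : ℝ}
    (hσ : 0 < σ) (hv : ∑ i ∈ Finset.range n, p i * (1 - p i) = σ ^ 2) (z : ℝ) :
    bernoulliSumExp p n (fun s => if (s - ∑ i ∈ Finset.range n, p i) / σ + 1 / σ ≤ z then 1 else 0)
        ≤ stdNormalCDF z + 8 * (1 / σ) ∧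
      stdNormalCDF z ≤ bernoulliSumExp p n
        (fun s => if (s - ∑ i ∈ Finset.range n, p i) / σ - 1 / σ ≤ z then 1 else 0) +
          8 * (1 / σ) := by
  set m := ∑ i ∈ Finset.range n, p i with hm
  set δ := 1 / σ with hδ
  have hδ0 : 0 < δ := by positivity
  set W : ℕ → ℝ := fun s => (s - m) / σ with hW
  have hWs : ∀ s, W (s + 1) = W s + δ := by
    intro s
    simp only [hW, hδ]
    push_cast
    ring
  set f := steinSolution z with hf
  have hstein := bernoulliSumExp_stein (p := p) n fun s => δ * f (W s)
  rw [← hm] at hstein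
  have hL : (fun s : ℕ => ((s : ℝ) - m) * (δ * f (W s))) = fun s => W s * f (W s) := by
    funext s
    simp only [hW, hδ]
    ring
  rw [hL] at hstein
  have habs : bernoulliSumExp p n (fun s => |W s|) ≤ 1 := by
    have hle : bernoulliSumExp p n (fun s => |W s|) ≤
        bernoulliSumExp p n (fun s => 1 / 2 + 1 / (2 * σ ^ 2) * ((s : ℝ) - m) ^ 2) := by
      refine bernoulliSumExp_mono h0 h1 n fun s => ?_
      have e : 1 / (2 * σ ^ 2) * ((s : ℝ) - m) ^ 2 = |W s| ^ 2 / 2 := by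
        rw [sq_abs]
        simp only [hW]
        field_simp
      rw [e]
      nlinarith [sq_nonneg (|W s| - 1)]
    rw [bernoulliSumExp_add, bernoulliSumExp_const, bernoulliSumExp_const_mul,
      bernoulliSumExp_sq, hv] at hle
    refine hle.trans (le_of_eq ?_)
    field_simp
    norm_num
  have hG : ∀ s, δ * f (W (s + 1)) - δ * f (W s) = δ * (f (W s + δ) - f (W s)) := by
    intro s
    rw [hWs]
    ring
  simp only [hG] at hstein
  have hδσ : σ ^ 2 * δ ^ 2 = 1 := by
    rw [hδ]
    field_simp
  -- On `[W s, W s + δ]` the function `x f(x)` is close to its value at either endpoint.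
  have hlip : ∀ u x, |x - u| ≤ δ → |x * f x - u * f u| ≤ (2 * |u| + 6) * δ := fun u x hx =>
    (abs_mul_steinSolution_sub_le z u x).trans
      (mul_le_mul_of_nonneg_left hx (by positivity))
  have hnear : ∀ s, ∀ x ∈ Set.Icc (W s) (W s + δ), |x - W s| ≤ δ ∧ |x - W (s + 1)| ≤ δ := by
    intro s x hx
    rw [hWs, abs_le, abs_le]
    refine ⟨⟨?_, ?_⟩, ?_, ?_⟩ <;> linarith [hx.1, hx.2]
  constructor
  · set I : ℕ → ℝ := fun s => if W s + δ ≤ z then 1 else 0 with hI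
    have hInc : ∀ s, I (s + 1) ≤ I s := by
      intro s
      simp only [hI, hWs]
      split_ifs <;> linarith
    have hlow := le_bernoulliLeaveOneOut h0 h1 n
      (G := fun s => δ * (f (W s + δ) - f (W s)))
      (H := fun s => δ ^ 2 * (W s * f (W s) +
        ((-2 * δ) * |W s| + (I s + (-(6 * δ) - stdNormalCDF z)))))
      (fun s => by
        have h := le_steinSolution_sub (z := z) (a := W s) (b := W s + δ)
          (c := W s * f (W s) - (2 * |W s| + 6) * δ) (by linarith)
          (fun x hx => by linarith [(abs_le.1 (hlip _ _ (hnear s x hx).1)).1])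
        simp only [add_sub_cancel_left] at h
        have h' := mul_le_mul_of_nonneg_left h hδ0.le
        refine le_trans (le_of_eq ?_) h'
        simp only [hI]
        ring)
      (fun s => by
        have h := le_steinSolution_sub (z := z) (a := W s) (b := W s + δ)
          (c := W (s + 1) * f (W (s + 1)) - (2 * |W (s + 1)| + 6) * δ) (by linarith)
          (fun x hx => by linarith [(abs_le.1 (hlip _ _ (hnear s x hx).2)).1])
        simp only [add_sub_cancel_left] at h
        have h' := mul_le_mul_of_nonneg_left h hδ0.le
        refine le_trans ?_ h'
        have h2 := mul_le_mul_of_nonneg_left (hInc s) (sq_nonneg δ)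
        have h3 : I s = if W s + δ ≤ z then 1 else 0 := rfl
        rw [← h3]
        linarith)
    rw [bernoulliSumExp_const_mul, hv, ← mul_assoc, hδσ, one_mul, ← hstein] at hlow
    simp only [bernoulliSumExp_add, bernoulliSumExp_const_mul, bernoulliSumExp_const] at hlow
    have h3 := mul_le_mul_of_nonneg_left habs hδ0.le
    linarith
  · set I : ℕ → ℝ := fun s => if W s - δ ≤ z then 1 else 0 with hI
    have hupp := bernoulliLeaveOneOut_le h0 h1 n
      (G := fun s => δ * (f (W s + δ) - f (W s)))
      (H := fun s => δ ^ 2 * (W s * f (W s) +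
        ((2 * δ) * |W s| + (I s + (6 * δ - stdNormalCDF z)))))
      (fun s => by
        have h := steinSolution_sub_le (z := z) (a := W s) (b := W s + δ)
          (c := W s * f (W s) + (2 * |W s| + 6) * δ) (by linarith)
          (fun x hx => by linarith [(abs_le.1 (hlip _ _ (hnear s x hx).1)).2])
        simp only [add_sub_cancel_left] at h
        have h' := mul_le_mul_of_nonneg_left h hδ0.le
        refine h'.trans ?_
        have h2 : (if W s ≤ z then (1 : ℝ) else 0) ≤ I s := by
          simp only [hI]
          split_ifs <;> linarith
        have h3 := mul_le_mul_of_nonneg_left h2 (sq_nonneg δ)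
        linarith)
      (fun s => by
        have h := steinSolution_sub_le (z := z) (a := W s) (b := W s + δ)
          (c := W (s + 1) * f (W (s + 1)) + (2 * |W (s + 1)| + 6) * δ) (by linarith)
          (fun x hx => by linarith [(abs_le.1 (hlip _ _ (hnear s x hx).2)).2])
        simp only [add_sub_cancel_left] at h
        have h' := mul_le_mul_of_nonneg_left h hδ0.le
        refine h'.trans (le_of_eq ?_)
        have h2 : I (s + 1) = if W s ≤ z then 1 else 0 := by
          simp only [hI, hWs, add_sub_cancel_right]
        rw [h2]
        ring)
    rw [bernoulliSumExp_const_mul, hv, ← mul_assoc, hδσ, one_mul, ← hstein] at hupp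
    simp only [bernoulliSumExp_add, bernoulliSumExp_const_mul, bernoulliSumExp_const] at hupp
    have h3 := mul_le_mul_of_nonneg_left habs hδ0.le
    linarith

/-- The Berry–Esseen bound for a sum of independent Bernoulli variables of variance `σ ^ 2`. -/
theorem abs_bernoulliSumExp_indicator_sub_le (h0 : ∀ i, 0 ≤ p i) (h1 : ∀ i, p i ≤ 1) (n : ℕ)
    {σ : ℝ} (hσ : 0 < σ) (hv : ∑ i ∈ Finset.range n, p i * (1 - p i) = σ ^ 2) (z : ℝ) :
    |bernoulliSumExp p n (fun s => if (s - ∑ i ∈ Finset.range n, p i) / σ ≤ z then 1 else 0) -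
      stdNormalCDF z| ≤ 9 * (1 / σ) := by
  have hδ : 0 ≤ 1 / σ := by positivity
  have hu := (bernoulliSumExp_indicator_bounds h0 h1 n hσ hv (z + 1 / σ)).1
  have hl := (bernoulliSumExp_indicator_bounds h0 h1 n hσ hv (z - 1 / σ)).2
  have h2 := stdNormalCDF_add_le z hδ
  have h3 := stdNormalCDF_add_le (z - 1 / σ) hδ
  simp only [add_le_add_iff_right, sub_le_sub_iff_right, sub_add_cancel] at hu hl h3
  rw [abs_le]
  constructor <;> linarith

end BernoulliSum

/-! ### The length of a Ewens partition as a sum of Bernoulli variables -/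

/-- The success probability `θ / (θ + i)` of the `i`-th Bernoulli summand (Feller's coupling). -/
noncomputable def fellerProb (θ : ℝ) (i : ℕ) : ℝ := θ / (θ + i)

theorem fellerProb_nonneg {θ : ℝ} (hθ : 0 < θ) (i : ℕ) : 0 ≤ fellerProb θ i := by
  unfold fellerProb
  positivity

theorem fellerProb_le_one {θ : ℝ} (hθ : 0 < θ) (i : ℕ) : fellerProb θ i ≤ 1 := by
  unfold fellerProb
  rw [div_le_one (by positivity)]
  linarith [Nat.cast_nonneg (α := ℝ) i]

theorem ewensLengthWeight_succ_succ {θ : ℝ} (hθ : 0 < θ) (n x : ℕ) :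
    ewensLengthWeight (n + 1) θ (x + 1) =
      (1 - fellerProb θ n) * ewensLengthWeight n θ (x + 1) +
        fellerProb θ n * ewensLengthWeight n θ x := by
  have hpos : 0 < (ascPochhammer ℝ n).eval θ := ascPochhammer_pos n θ hθ
  have hθn : 0 < θ + n := by positivity
  rw [ewensLengthWeight, ascPochhammer_succ_eval]
  simp only [ewensLengthWeight, fellerProb, ascPochhammer_succ_right, mul_add,
    Polynomial.coeff_add, Polynomial.coeff_mul_X, Polynomial.coeff_mul_natCast]
  push_cast
  field_simp
  ring

theorem ewensLengthWeight_succ_zero {θ : ℝ} (hθ : 0 < θ) (n : ℕ) :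
    ewensLengthWeight (n + 1) θ 0 = (1 - fellerProb θ n) * ewensLengthWeight n θ 0 := by
  have hpos : 0 < (ascPochhammer ℝ n).eval θ := ascPochhammer_pos n θ hθ
  have hθn : 0 < θ + n := by positivity
  rw [ewensLengthWeight, ascPochhammer_succ_eval]
  simp only [ewensLengthWeight, fellerProb, ascPochhammer_succ_right, mul_add,
    Polynomial.coeff_add, Polynomial.coeff_mul_X_zero, Polynomial.coeff_mul_natCast]
  push_cast
  field_simp
  ring

theorem ewensLengthWeight_eq_zero_of_lt (θ : ℝ) {n x : ℕ} (h : n < x) :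
    ewensLengthWeight n θ x = 0 := by
  rw [ewensLengthWeight, Polynomial.coeff_eq_zero_of_natDegree_lt
    (by rwa [ascPochhammer_natDegree])]
  simp

theorem sum_ewensLengthWeight_mul {θ : ℝ} (hθ : 0 < θ) (n : ℕ) (g : ℕ → ℝ) :
    ∑ x ∈ Finset.range (n + 1), ewensLengthWeight n θ x * g x =
      bernoulliSumExp (fellerProb θ) n g := by
  induction n generalizing g with
  | zero => simp [ewensLengthWeight, bernoulliSumExp]
  | succ n ih =>
    have h1 : ∑ x ∈ Finset.range (n + 1), ewensLengthWeight n θ (x + 1) * g (x + 1) +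
        ewensLengthWeight n θ 0 * g 0 = bernoulliSumExp (fellerProb θ) n g := by
      rw [← ih, ← Finset.sum_range_succ' (fun x => ewensLengthWeight n θ x * g x),
        Finset.sum_range_succ _ (n + 1), ewensLengthWeight_eq_zero_of_lt θ n.lt_succ_self,
        zero_mul, add_zero]
    rw [Finset.sum_range_succ', bernoulliSumExp, ← h1, ← ih, ewensLengthWeight_succ_zero hθ,
      mul_add, Finset.mul_sum, Finset.mul_sum]
    simp only [ewensLengthWeight_succ_succ hθ, add_mul, Finset.sum_add_distrib, mul_assoc]
    ring

theorem integral_ewensLengthLaw {θ : ℝ} (hθ : 0 < θ) {n : ℕ} (hn : 1 ≤ n) (g : ℕ → ℝ) :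
    ∫ x, g x ∂ewensLengthLaw n θ = bernoulliSumExp (fellerProb θ) n g := by
  have hw : ∀ x, 0 ≤ ewensLengthWeight n θ x := fun x =>
    div_nonneg (mul_nonneg (Nat.cast_nonneg _) (pow_nonneg hθ.le _)) (ascPochhammer_pos n θ hθ).le
  have h0 : ewensLengthWeight n θ 0 = 0 := by
    rw [ewensLengthWeight, Polynomial.coeff_zero_eq_eval_zero, ascPochhammer_eval_zero,
      if_neg (by omega)]
    simp
  rw [← sum_ewensLengthWeight_mul hθ, Finset.sum_range_succ', h0, zero_mul, add_zero,
    ewensLengthLaw, integral_finsetSum_measure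
      fun x _ => (integrable_dirac (by simp)).smul_measure ENNReal.ofReal_ne_top]
  simp only [integral_smul_measure, integral_dirac, smul_eq_mul, ENNReal.toReal_ofReal (hw _)]
  rw [Finset.range_eq_Ico, Finset.sum_Ico_add' (fun x => ewensLengthWeight n θ x * g x) 0 n 1]
  rfl

section EwensLength

variable {Ω : Type*} [MeasurableSpace Ω] {P : Measure Ω} {K : Ω → ℕ} {θ : ℝ} {n : ℕ}

theorem integral_comp_ewensLength (hθ : 0 < θ) (hn : 1 ≤ n)
    (hK : HasLaw K (ewensLengthLaw n θ) P) (g : ℕ → ℝ) :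
    ∫ ω, g (K ω) ∂P = bernoulliSumExp (fellerProb θ) n g := by
  rw [← integral_ewensLengthLaw hθ hn]
  exact hK.integral_comp (f := g) (measurable_of_countable g).aestronglyMeasurable

theorem variance_ewensLength (hθ : 0 < θ) (hn : 1 ≤ n)
    (hK : HasLaw K (ewensLengthLaw n θ) P) :
    variance (fun ω => (K ω : ℝ)) P =
      ∑ i ∈ Finset.range n, fellerProb θ i * (1 - fellerProb θ i) := by
  have hmeas : AEMeasurable (fun ω => (K ω : ℝ)) P :=
    (measurable_of_countable (fun k : ℕ => (k : ℝ))).comp_aemeasurable hK.aemeasurable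
  rw [variance_eq_integral hmeas, integral_comp_ewensLength hθ hn hK (fun k => (k : ℝ)),
    bernoulliSumExp_id, integral_comp_ewensLength hθ hn hK
      (fun k => ((k : ℝ) - ∑ i ∈ Finset.range n, fellerProb θ i) ^ 2), bernoulliSumExp_sq]

theorem standardizedCDF_ewensLength (hθ : 0 < θ) (hn : 1 ≤ n)
    (hK : HasLaw K (ewensLengthLaw n θ) P) (z : ℝ) :
    standardizedCDF P K z = bernoulliSumExp (fellerProb θ) n (fun s =>
      if (s - ∑ i ∈ Finset.range n, fellerProb θ i) /
        √(∑ i ∈ Finset.range n, fellerProb θ i * (1 - fellerProb θ i)) ≤ z then 1 else 0) := by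
  set m := ∑ i ∈ Finset.range n, fellerProb θ i
  set σ := √(∑ i ∈ Finset.range n, fellerProb θ i * (1 - fellerProb θ i))
  rw [← integral_ewensLengthLaw hθ hn]
  have hset : {ω | standardized P K ω ≤ z} = K ⁻¹' {k : ℕ | ((k : ℝ) - m) / σ ≤ z} := by
    ext ω
    simp only [standardized, variance_ewensLength hθ hn hK,
      integral_comp_ewensLength hθ hn hK (fun k => (k : ℝ)), bernoulliSumExp_id]
    rfl
  rw [standardizedCDF, hset, measureReal_def,
    ← Measure.map_apply_of_aemeasurable hK.aemeasurable MeasurableSet.of_discrete, hK.map_eq,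
    ← measureReal_def, ← integral_indicator_one MeasurableSet.of_discrete]
  rfl

theorem normalApproxError_nonneg : 0 ≤ normalApproxError P K :=
  Real.iSup_nonneg fun _ => abs_nonneg _

theorem normalApproxError_le_one [IsProbabilityMeasure P] : normalApproxError P K ≤ 1 := by
  refine Real.iSup_le (fun x => ?_) zero_le_one
  have h1 : 0 ≤ standardizedCDF P K x := measureReal_nonneg
  have h2 : standardizedCDF P K x ≤ 1 := measureReal_le_one
  have h3 := stdNormalCDF_nonneg x
  have h4 := stdNormalCDF_le_one x
  rw [abs_le]
  constructor <;> linarith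

theorem normalApproxError_ewensLength_le [IsProbabilityMeasure P] (hθ : 0 < θ) (hn : 1 ≤ n)
    (hK : HasLaw K (ewensLengthLaw n θ) P)
    (hv : 0 < ∑ i ∈ Finset.range n, fellerProb θ i * (1 - fellerProb θ i)) :
    normalApproxError P K ≤
      9 * (1 / √(∑ i ∈ Finset.range n, fellerProb θ i * (1 - fellerProb θ i))) := by
  refine Real.iSup_le (fun z => ?_) (by positivity)
  rw [standardizedCDF_ewensLength hθ hn hK]
  exact abs_bernoulliSumExp_indicator_sub_le (fellerProb_nonneg hθ) (fellerProb_le_one hθ) n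
    (Real.sqrt_pos.2 hv) (Real.sq_sqrt hv.le).symm z

end EwensLength

/-! ### Comparison of the variance with the rate -/

theorem log_le_sum_fellerProb {θ : ℝ} (hθ : 0 < θ) (n : ℕ) :
    θ * Real.log (1 + n / θ) ≤ ∑ i ∈ Finset.range n, fellerProb θ i := by
  induction n with
  | zero => simp
  | succ n ih =>
    have hθn : 0 < θ + n := by positivity
    have h1 : (1 + ((n + 1 : ℕ) : ℝ) / θ) = (1 + n / θ) * (1 + 1 / (θ + n)) := by
      push_cast
      field_simp
      ring
    have h2 : Real.log (1 + 1 / (θ + n)) ≤ 1 / (θ + n) := by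
      have := Real.log_le_sub_one_of_pos (show 0 < 1 + 1 / (θ + n) by positivity)
      linarith
    rw [h1, Real.log_mul (by positivity) (by positivity), Finset.sum_range_succ, fellerProb]
    have h3 := mul_le_mul_of_nonneg_left h2 hθ.le
    rw [mul_one_div] at h3
    linarith

theorem sum_fellerProb_sq_le {θ : ℝ} (hθ : 0 < θ) (n : ℕ) :
    ∑ i ∈ Finset.range n, fellerProb θ i ^ 2 ≤ 1 + θ - θ ^ 2 / (θ + n) := by
  -- The bound with `n` on the right holds already for the sum of `n + 1` terms, which telescopes.
  have key : ∀ n : ℕ, ∑ i ∈ Finset.range (n + 1), fellerProb θ i ^ 2 ≤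
      1 + θ - θ ^ 2 / (θ + n) := by
    intro n
    induction n with
    | zero =>
      simp only [fellerProb, zero_add, Finset.sum_range_one, Nat.cast_zero, add_zero]
      refine le_of_eq ?_
      field_simp
      ring
    | succ n ih =>
      rw [Finset.sum_range_succ]
      have hθn : 0 < θ + n := by positivity
      have h : fellerProb θ (n + 1) ^ 2 ≤
          θ ^ 2 / (θ + n) - θ ^ 2 / (θ + ((n + 1 : ℕ) : ℝ)) := by
        have e : θ ^ 2 / (θ + n) - θ ^ 2 / (θ + ((n + 1 : ℕ) : ℝ)) =
            θ ^ 2 / ((θ + n) * (θ + ((n + 1 : ℕ) : ℝ))) := by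
          push_cast
          field_simp
          ring
        rw [e, fellerProb, div_pow, sq (θ + _)]
        push_cast
        gcongr
        linarith
      linarith
  exact (Finset.sum_le_sum_of_subset_of_nonneg (Finset.range_mono n.le_succ)
    fun _ _ _ => sq_nonneg _).trans (key n)

theorem le_sum_fellerProb_variance {θ : ℝ} (hθ : 0 < θ) (n : ℕ) :
    θ * (Real.log (1 + n / θ) - 1 + θ / (n + θ)) - 1 ≤
      ∑ i ∈ Finset.range n, fellerProb θ i * (1 - fellerProb θ i) := by
  have h1 := log_le_sum_fellerProb hθ n
  have h2 := sum_fellerProb_sq_le hθ n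
  have h3 : ∑ i ∈ Finset.range n, fellerProb θ i * (1 - fellerProb θ i) =
      ∑ i ∈ Finset.range n, fellerProb θ i - ∑ i ∈ Finset.range n, fellerProb θ i ^ 2 := by
    rw [← Finset.sum_sub_distrib]
    exact Finset.sum_congr rfl fun i _ => by ring
  have h4 : θ * (θ / (n + θ)) = θ ^ 2 / (θ + n) := by
    rw [add_comm]
    ring
  rw [h3, mul_add, h4]
  linarith

/-- The function `t ↦ log (1 + t) - 1 + 1 / (1 + t)` at `t = n / θ` is of order at least `t ^ 2`
for small `t`. -/
theorem sq_div_le_log_one_add_sub {t : ℝ} (ht : 0 < t) :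
    t ^ 2 / ((t + 2) * (1 + t)) ≤ Real.log (1 + t) - 1 + 1 / (1 + t) := by
  have h := Real.le_log_one_add_of_nonneg ht.le
  have e : t ^ 2 / ((t + 2) * (1 + t)) = 2 * t / (t + 2) - 1 + 1 / (1 + t) := by
    field_simp
    ring
  linarith

theorem rate_arg_eq {θ : ℝ} (hθ : 0 < θ) (n : ℕ) :
    θ * (Real.log (1 + n / θ) - 1 + θ / (n + θ)) =
      θ * (Real.log (1 + n / θ) - 1 + 1 / (1 + n / θ)) := by
  congr 2
  field_simp
  ring

/-- The bound by the general rate holds with an absolute constant: where the variance is not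
comparable with the rate, the rate is at least `1 / √2`. -/
theorem normalApproxError_ewensLength_le_generalRate {Ω : Type*} [MeasurableSpace Ω]
    {P : Measure Ω} [IsProbabilityMeasure P] {K : Ω → ℕ} {θ : ℝ} {n : ℕ} (hθ : 0 < θ)
    (hn : 1 ≤ n) (hK : HasLaw K (ewensLengthLaw n θ) P) :
    normalApproxError P K ≤ 18 * generalRate n θ := by
  have hn' : (0 : ℝ) < n := by exact_mod_cast hn
  have hLv := le_sum_fellerProb_variance hθ n
  have hL0 : 0 < θ * (Real.log (1 + n / θ) - 1 + θ / (n + θ)) := by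
    rw [rate_arg_eq hθ]
    exact mul_pos hθ (lt_of_lt_of_le (by positivity) (sq_div_le_log_one_add_sub (by positivity)))
  rw [generalRate]
  set L := θ * (Real.log (1 + n / θ) - 1 + θ / (n + θ))
  rcases le_total 2 L with h | h
  · set v := ∑ i ∈ Finset.range n, fellerProb θ i * (1 - fellerProb θ i) with hv
    have hv0 : 0 < v := by linarith
    refine (normalApproxError_ewensLength_le hθ hn hK hv0).trans ?_
    rw [← hv]
    have h1 : √L ≤ 2 * √v := by
      rw [show (2 : ℝ) = √4 by rw [show (4 : ℝ) = 2 ^ 2 by norm_num]; simp,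
        ← Real.sqrt_mul (by norm_num)]
      exact Real.sqrt_le_sqrt (by linarith)
    have h2 : 0 < √L := Real.sqrt_pos.2 hL0
    have h3 : 0 < √v := Real.sqrt_pos.2 hv0
    rw [mul_one_div, mul_one_div, div_le_div_iff₀ h3 h2]
    linarith
  · refine normalApproxError_le_one.trans ?_
    have h1 : √L ≤ 2 := by
      rw [Real.sqrt_le_left (by norm_num)]
      linarith
    rw [mul_one_div, le_div_iff₀ (Real.sqrt_pos.2 hL0)]
    linarith

theorem isBigO_one_div_sqrt {ι : Type*} {l : Filter ι} {u v : ι → ℝ} {c : ℝ} (hc : 0 < c)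
    (h : ∀ᶠ n in l, 0 < v n ∧ c * v n ≤ u n) :
    (fun n => 1 / √(u n)) =O[l] fun n => 1 / √(v n) := by
  refine IsBigO.of_bound (1 / √c) ?_
  filter_upwards [h] with n hn
  rw [Real.norm_of_nonneg (by positivity), Real.norm_of_nonneg (by positivity),
    div_mul_div_comm, one_mul, ← Real.sqrt_mul hc.le]
  exact one_div_le_one_div_of_le (Real.sqrt_pos.2 (mul_pos hc hn.1)) (Real.sqrt_le_sqrt hn.2)

section Rates

variable {θ : ℕ → ℝ}

theorem generalRate_isBigO_of_tendsto_atTop (hθ : ∀ n, 1 ≤ n → 0 < θ n)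
    (h : Tendsto (fun n : ℕ => (n : ℝ) / θ n) atTop atTop) :
    (fun n => generalRate n (θ n)) =O[atTop]
      fun n : ℕ => 1 / √(θ n * Real.log ((n : ℝ) / θ n)) := by
  refine isBigO_one_div_sqrt (c := 1 / 2) (by norm_num) ?_
  filter_upwards [h.eventually_ge_atTop (Real.exp 2), eventually_ge_atTop 1] with n ht hn
  have hθn := hθ n hn
  have ht0 : 0 < (n : ℝ) / θ n := (Real.exp_pos 2).trans_le ht
  have h2 : 2 ≤ Real.log ((n : ℝ) / θ n) := (Real.le_log_iff_exp_le ht0).2 ht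
  have h3 : Real.log ((n : ℝ) / θ n) ≤ Real.log (1 + (n : ℝ) / θ n) :=
    Real.log_le_log ht0 (by linarith)
  refine ⟨mul_pos hθn (by linarith), ?_⟩
  have h4 : 0 ≤ θ n / (n + θ n) := by positivity
  have h5 := mul_le_mul_of_nonneg_left (show 1 / 2 * Real.log ((n : ℝ) / θ n) ≤
    Real.log (1 + (n : ℝ) / θ n) - 1 + θ n / (n + θ n) by linarith) hθn.le
  linarith

theorem generalRate_isBigO_of_tendsto_pos (hθ : ∀ n, 1 ≤ n → 0 < θ n) {c : ℝ} (hc : 0 < c)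
    (h : Tendsto (fun n : ℕ => (n : ℝ) / θ n) atTop (nhds c)) :
    (fun n => generalRate n (θ n)) =O[atTop] fun n : ℕ => 1 / √(θ n) := by
  set g : ℝ → ℝ := fun t => t ^ 2 / ((t + 2) * (1 + t)) with hg
  have hgc : 0 < g c := by positivity
  have hcont : Tendsto (fun n : ℕ => g ((n : ℝ) / θ n)) atTop (nhds (g c)) := by
    have : ContinuousAt g c := by
      refine ContinuousAt.div (by fun_prop) (by fun_prop) ?_
      positivity
    exact this.tendsto.comp h
  refine isBigO_one_div_sqrt (c := g c / 2) (by positivity) ?_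
  filter_upwards [hcont.eventually_const_lt (half_lt_self hgc), eventually_ge_atTop 1]
    with n hgn hn
  have hθn := hθ n hn
  have hn' : (0 : ℝ) < n := by exact_mod_cast hn
  refine ⟨hθn, ?_⟩
  rw [rate_arg_eq hθn, mul_comm]
  exact mul_le_mul_of_nonneg_left
    (hgn.le.trans (sq_div_le_log_one_add_sub (by positivity))) hθn.le

theorem generalRate_isBigO_of_tendsto_zero (hθ : ∀ n, 1 ≤ n → 0 < θ n)
    (h : Tendsto (fun n : ℕ => (n : ℝ) / θ n) atTop (nhds 0)) :
    (fun n => generalRate n (θ n)) =O[atTop] fun n : ℕ => 1 / √((n : ℝ) ^ 2 / θ n) := by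
  refine isBigO_one_div_sqrt (c := 1 / 6) (by norm_num) ?_
  filter_upwards [h.eventually_lt_const zero_lt_one, eventually_ge_atTop 1] with n ht hn
  have hθn := hθ n hn
  have hn' : (0 : ℝ) < n := by exact_mod_cast hn
  refine ⟨by positivity, ?_⟩
  have ht0 : 0 < (n : ℝ) / θ n := by positivity
  rw [rate_arg_eq hθn]
  have e : 1 / 6 * ((n : ℝ) ^ 2 / θ n) = θ n * (((n : ℝ) / θ n) ^ 2 / 6) := by
    field_simp
  rw [e]
  refine mul_le_mul_of_nonneg_left (le_trans ?_ (sq_div_le_log_one_add_sub ht0)) hθn.le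
  exact div_le_div_of_nonneg_left (by positivity) (by positivity) (by nlinarith)

end Rates

theorem corollary1 (θ : ℕ → ℝ) (hθ_pos : ∀ n, 1 ≤ n → 0 < θ n)
    (hθ_mono : ∀ m n, 1 ≤ m → m ≤ n → θ m ≤ θ n)
    {Ω : ℕ → Type*} [∀ n, MeasurableSpace (Ω n)]
    (P : ∀ n, Measure (Ω n)) [∀ n, IsProbabilityMeasure (P n)]
    (K : ∀ n, Ω n → ℕ)
    (hK : ∀ n, 1 ≤ n → HasLaw (K n) (ewensLengthLaw n (θ n)) (P n)) :
    -- Case A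
    (Tendsto (fun n : ℕ => (n : ℝ) / θ n) atTop atTop →
      (fun n => normalApproxError (P n) (K n)) =O[atTop] (fun n => generalRate n (θ n)) ∧
      (fun n => generalRate n (θ n)) =O[atTop]
        (fun n : ℕ => 1 / √(θ n * Real.log ((n : ℝ) / θ n))) ∧
      (fun n => normalApproxError (P n) (K n)) =O[atTop]
        (fun n : ℕ => 1 / √(θ n * Real.log ((n : ℝ) / θ n)))) ∧
    -- Case B
    (∀ c : ℝ, 0 < c → Tendsto (fun n : ℕ => (n : ℝ) / θ n) atTop (nhds c) →
      (fun n => normalApproxError (P n) (K n)) =O[atTop] (fun n => generalRate n (θ n)) ∧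
      (fun n => generalRate n (θ n)) =O[atTop] (fun n : ℕ => 1 / √(θ n)) ∧
      (fun n => normalApproxError (P n) (K n)) =O[atTop] (fun n : ℕ => 1 / √(θ n))) ∧
    -- Case C1
    (Tendsto (fun n : ℕ => (n : ℝ) / θ n) atTop (nhds 0) →
      Tendsto (fun n : ℕ => (n : ℝ) ^ 2 / θ n) atTop atTop →
      (fun n => normalApproxError (P n) (K n)) =O[atTop] (fun n => generalRate n (θ n)) ∧
      (fun n => generalRate n (θ n)) =O[atTop] (fun n : ℕ => 1 / √((n : ℝ) ^ 2 / θ n)) ∧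
      (fun n => normalApproxError (P n) (K n)) =O[atTop]
        (fun n : ℕ => 1 / √((n : ℝ) ^ 2 / θ n))) := by
  have hmain : (fun n => normalApproxError (P n) (K n)) =O[atTop]
      (fun n => generalRate n (θ n)) := by
    refine IsBigO.of_bound 18 ?_
    filter_upwards [eventually_ge_atTop 1] with n hn
    rw [Real.norm_of_nonneg normalApproxError_nonneg,
      Real.norm_of_nonneg (by unfold generalRate; positivity)]
    exact normalApproxError_ewensLength_le_generalRate (hθ_pos n hn) hn (hK n hn)
  refine ⟨fun h => ?_, fun c hc h => ?_, fun h _ => ?_⟩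
  · have hr := generalRate_isBigO_of_tendsto_atTop hθ_pos h
    exact ⟨hmain, hr, hmain.trans hr⟩
  · have hr := generalRate_isBigO_of_tendsto_pos hθ_pos hc h
    exact ⟨hmain, hr, hmain.trans hr⟩
  · have hr := generalRate_isBigO_of_tendsto_zero hθ_pos h
    exact ⟨hmain, hr, hmain.trans hr⟩
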